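/- Let $X$ be a real or complex Banach space that is an $L^1$-predual, i.e. its dual $X^*$ is linearly isometric to $L^1(\mu)$ (over the same scalars) for some measure $\mu$. Let $\operatorname{ex} B_{X^*}$ be the set of extreme points of the closed unit ball of $X^*$, equipped with the weak$^*$ topology, let $p\sim q$ mean that $p,q\in \operatorname{ex} B_{X^*}$ are linearly dependent, and equip $\operatorname{ex} B_{X^*}/{\sim}$ with the quotient topology. Suppose that $\operatorname{ex} B_{X^*}/{\sim}$ has no isolated point. Let $T\colon X\to X$ be a bounded linear operator such that either 1. $T$ is weakly compact, i.e. the image under $T$ of the closed unit ball of $X$ is relatively weakly compact, or 2. $T$ factors through a subspace of $c_0$, i.e. there are a closed subspace $E\subset c_0$ and bounded linear operators $T_1\colon X\to E$ and $T_2\colon E\to X$ with $T=T_2T_1$. Then $T$ satisfies the Daugavet equation $\|I+T\| = 1+\|T\|$. -/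

import Mathlib

open scoped ZeroAtInfty

universe u v w

namespace Daugavet

section Definitions

variable (𝕜 : Type u) [RCLike 𝕜] (X : Type v) [NormedAddCommGroup X] [NormedSpace 𝕜 X]

/-- `X` is an `L¹`-predual: its dual space is linearly isometric to `L¹(μ)` (with scalars `𝕜`)
for some measure space `(Ω, μ)`. -/
def IsL1Predual : Prop :=
  ∃ (Ω : Type w) (_ : MeasurableSpace Ω) (μ : MeasureTheory.Measure Ω),
    Nonempty (StrongDual 𝕜 X ≃ₗᵢ[𝕜] MeasureTheory.Lp 𝕜 1 μ)

/-- The set of extreme points of the closed unit ball of the dual of `X`, as a subset of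
`WeakDual 𝕜 X`, so that its subspace topology is the weak* topology. -/
def extBall : Set (WeakDual 𝕜 X) :=
  {p | WeakDual.toStrongDual p ∈
    Set.extremePoints ℝ (Metric.closedBall (0 : StrongDual 𝕜 X) 1)}

variable {𝕜 X}

/-- Two functionals are linearly dependent over `𝕜`. -/
def LinDep (p q : WeakDual 𝕜 X) : Prop := ¬ LinearIndependent 𝕜 ![p, q]

theorem ne_zero_of_mem_extBall [Nontrivial X] {p : WeakDual 𝕜 X} (hp : p ∈ extBall 𝕜 X) :
    p ≠ 0 := by
  rintro rfl
  obtain ⟨x, hx⟩ := exists_ne (0 : X)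
  obtain ⟨g, hg, -⟩ := exists_dual_vector 𝕜 x (norm_ne_zero_iff.2 hx)
  have h := hp.2 (x₁ := g) (x₂ := -g) (by simp [hg]) (by simp [hg])
    ⟨1 / 2, 1 / 2, by norm_num, by norm_num, by norm_num, by simp⟩
  have h0 : g = 0 := h
  rw [h0, norm_zero] at hg
  exact zero_ne_one hg

theorem linDep_iff {p q : WeakDual 𝕜 X} (hp : p ≠ 0) :
    LinDep p q ↔ ∃ a : 𝕜, a • p = q := by
  unfold LinDep
  rw [LinearIndependent.pair_iff' hp]
  push Not
  rfl

variable (𝕜 X)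

/-- Linear dependence, as an equivalence relation on the extreme points of the dual unit ball. -/
def extSetoid : Setoid (extBall 𝕜 X) where
  r p q := LinDep (p : WeakDual 𝕜 X) (q : WeakDual 𝕜 X)
  iseqv := by
    rcases subsingleton_or_nontrivial X with hX | hX
    · have key : ∀ p q : WeakDual 𝕜 X, LinDep p q := by
        intro p q h
        refine h.ne_zero 0 ?_
        refine DFunLike.ext _ _ fun x => ?_
        rw [Subsingleton.elim x 0]
        simp
      exact ⟨fun _ => key _ _, fun _ => key _ _, fun _ _ => key _ _⟩
    · have hne : ∀ p : extBall 𝕜 X, (p : WeakDual 𝕜 X) ≠ 0 :=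
        fun p => ne_zero_of_mem_extBall p.2
      refine ⟨fun p => ?_, fun {p q} h => ?_, fun {p q r} h h' => ?_⟩
      · rw [linDep_iff (hne p)]
        exact ⟨1, one_smul _ _⟩
      · rw [linDep_iff (hne p)] at h
        rw [linDep_iff (hne q)]
        obtain ⟨a, ha⟩ := h
        have ha0 : a ≠ 0 := by
          rintro rfl
          exact hne q (by rw [← ha, zero_smul])
        exact ⟨a⁻¹, by rw [← ha, smul_smul, inv_mul_cancel₀ ha0, one_smul]⟩
      · rw [linDep_iff (hne p)] at h ⊢
        rw [linDep_iff (hne q)] at h'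
        obtain ⟨a, ha⟩ := h
        obtain ⟨b, hb⟩ := h'
        exact ⟨b * a, by rw [mul_smul, ha, hb]⟩

/-- The quotient of the extreme points of the dual unit ball by linear dependence; Mathlib's
instance equips it with the quotient topology of the weak* topology. -/
abbrev ExtQuotient : Type _ := Quotient (extSetoid 𝕜 X)

variable {𝕜 X}

/-- An operator is weakly compact if the image of the closed unit ball is relatively compact
in the weak topology. -/
def IsWeaklyCompact (T : X →L[𝕜] X) : Prop :=
  IsCompact (closure (toWeakSpace 𝕜 X '' (T '' Metric.closedBall (0 : X) 1)))

/-- `T` factors through a closed subspace `E` of `c₀ = C₀(ℕ, 𝕜)` by bounded operators. -/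
def FactorsThroughSubspaceOfC0 (T : X →L[𝕜] X) : Prop :=
  ∃ E : Submodule 𝕜 C₀(ℕ, 𝕜), IsClosed (E : Set C₀(ℕ, 𝕜)) ∧
    ∃ (T₁ : X →L[𝕜] E) (T₂ : E →L[𝕜] X), T = T₂.comp T₁

/-- The Daugavet equation `‖I + T‖ = 1 + ‖T‖` in the operator norm. -/
def SatisfiesDaugavet (T : X →L[𝕜] X) : Prop :=
  ‖ContinuousLinearMap.id 𝕜 X + T‖ = 1 + ‖T‖

end Definitions

end Daugavet

/-!
An extreme point `p` of the unit ball of `L¹(μ)` is a multiple of the indicator of an atom, so that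
`L¹(μ) = 𝕜 p ⊕₁ F`: there is a functional `χ`, the coordinate at `p`, with
`‖f‖ = ‖χ f‖ + ‖f - χ f • p‖` (`IsLCoordinate`, `exists_isLCoordinate_Lp`). This passes to the dual
of an `L¹`-predual `X`. Inequivalent extreme points have coordinate `0` at each other, and hence the
coordinates of any functional are absolutely summable (`sum_norm_coordinate_le`).

For an extreme point `p` with coordinate `χ`,
`‖I + T‖ ≥ ‖p + p ∘ T‖ ≥ 1 + ‖p ∘ T‖ - 2 ‖χ (p ∘ T)‖`.
So the Daugavet equation follows once every vector `y` is almost normed by extreme points `p` for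
which the diagonal coordinate `χ (p ∘ T)` is small (`satisfiesDaugavet_of_small_diagonal`).

If `T` factors through a subspace of `c₀`, all functionals `p ∘ T` are sums of series in a fixed
sequence of functionals, because the dual of `c₀` is `ℓ¹`. So the diagonal coordinate vanishes
outside a countable set of classes of extreme points, and it is enough to norm `y` outside of a
countable set of classes. As no class `s` is isolated, the open set of vectors that do not attain
their norm at `s` is dense (`dense_setOf_norm_rep_apply_lt`). By the Baire category theorem in `X`
there are vectors close to `y` that attain their norm at no class of the countable set, although,
by the Krein–Milman theorem, they attain it at some extreme point
(`exists_notMem_countable_lt_norm_rep_apply`).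

If `T` is weakly compact, its second adjoint maps the bidual into `X`
(`IsWeaklyCompact.exists_apply_comp_eq`). So for a fixed coordinate `χ` the map `p ↦ χ (p ∘ T)` is
weak* continuous. If the diagonal coordinates were bounded below by `ε` on a nonempty open set, one
could choose, one after the other and because no class is isolated, classes `s₁, …, sₙ` and a point
`p` with all of the coordinates of `p ∘ T` at `s₁, …, sₙ` greater than `ε / 2`
(`IsWeaklyCompact.exists_finset_lt_coordinate`). For large `n` this contradicts the summability of
the coordinates.
-/

namespace Daugavet

open MeasureTheory Filter Set

/-! ### Extreme points and `L`-decompositions -/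

section LCoordinates

variable {𝕜 : Type*} [RCLike 𝕜] {E : Type*} [NormedAddCommGroup E] [NormedSpace 𝕜 E]

/-- The functional `χ` is the coordinate of an `L`-decomposition `E = 𝕜 p ⊕₁ F`: it reads off the
coefficient at `p`, and the norm of `f` is the sum of the norms of its two components `χ f • p` and
`f - χ f • p`. The two fields together force `‖p‖ = 1`. -/
structure IsLCoordinate (p : E) (χ : StrongDual 𝕜 E) : Prop where
  apply_self : χ p = 1
  norm_eq : ∀ f, ‖f‖ = ‖χ f‖ + ‖f - χ f • p‖

/-- An extreme point of the unit ball that is an `ℓ¹`-sum of two vectors is a multiple of each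
of them. -/
theorem exists_smul_eq_of_mem_extremePoints [NormedSpace ℝ E] {p a b : E}
    (hp : p ∈ extremePoints ℝ (Metric.closedBall (0 : E) 1)) (hab : p = a + b)
    (hn : ‖a‖ + ‖b‖ ≤ 1) : ∃ t : ℝ, a = t • p := by
  rcases eq_or_ne a 0 with rfl | ha
  · exact ⟨0, by simp⟩
  rcases eq_or_ne b 0 with rfl | hb
  · exact ⟨1, by simp [hab]⟩
  have ha' : 0 < ‖a‖ := norm_pos_iff.2 ha
  have hb' : 0 < ‖b‖ := norm_pos_iff.2 hb
  have hs : 0 < ‖a‖ + ‖b‖ := by positivity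
  have mem : ∀ c : E, 0 < ‖c‖ → ((‖a‖ + ‖b‖) / ‖c‖) • c ∈ Metric.closedBall (0 : E) 1 := by
    intro c hc
    rw [mem_closedBall_zero_iff, norm_smul, Real.norm_of_nonneg (by positivity),
      div_mul_cancel₀ _ hc.ne']
    exact hn
  have h := hp.2 (mem a ha') (mem b hb')
    ⟨‖a‖ / (‖a‖ + ‖b‖), ‖b‖ / (‖a‖ + ‖b‖), by positivity, by positivity,
      by field_simp, ?_⟩
  · refine ⟨‖a‖ / (‖a‖ + ‖b‖), ?_⟩
    rw [← h, smul_smul, div_mul_div_cancel₀ hs.ne', div_self ha'.ne', one_smul]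
  · rw [smul_smul, smul_smul, div_mul_div_cancel₀ hs.ne', div_mul_div_cancel₀ hs.ne',
      div_self ha'.ne', div_self hb'.ne', one_smul, one_smul, hab]

theorem norm_eq_one_of_mem_extremePoints [NormedSpace ℝ E] {p : E}
    (hp : p ∈ extremePoints ℝ (Metric.closedBall (0 : E) 1)) (h0 : p ≠ 0) : ‖p‖ = 1 := by
  have h1 : ‖p‖ ≤ 1 := by simpa using hp.1
  have hpos : 0 < ‖p‖ := norm_pos_iff.2 h0
  by_contra hne
  have hlt : ‖p‖ < 1 := lt_of_le_of_ne h1 hne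
  refine h0 (hp.2 (x₁ := 0) (x₂ := ‖p‖⁻¹ • p) (by simp) ?_
    ⟨1 - ‖p‖, ‖p‖, by linarith, hpos, by ring, ?_⟩).symm
  · simp [norm_smul, hpos.ne']
  · rw [smul_zero, zero_add, smul_smul, mul_inv_cancel₀ hpos.ne', one_smul]

end LCoordinates

/-! ### Extreme points of the unit ball of `L¹(μ)` -/

section L1

variable {𝕜 : Type*} [RCLike 𝕜] {Ω : Type*} [MeasurableSpace Ω] {μ : Measure Ω}

/-- The support of an extreme point of the unit ball of `L¹(μ)` is an atom. -/
theorem ae_mem_or_ae_notMem_of_mem_extremePoints {p : Lp 𝕜 1 μ}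
    (hp : p ∈ extremePoints ℝ (Metric.closedBall (0 : Lp 𝕜 1 μ) 1))
    {B : Set Ω} (hB : MeasurableSet B) :
    (∀ᵐ x ∂μ, p x ≠ 0 → x ∈ B) ∨ (∀ᵐ x ∂μ, p x ≠ 0 → x ∉ B) := by
  have hm := Lp.memLp p
  set a : Lp 𝕜 1 μ := (hm.indicator hB).toLp
  set b : Lp 𝕜 1 μ := (hm.indicator hB.compl).toLp
  have ha : a =ᵐ[μ] B.indicator p := (hm.indicator hB).coeFn_toLp
  have hb : b =ᵐ[μ] Bᶜ.indicator p := (hm.indicator hB.compl).coeFn_toLp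
  have hab : p = a + b := by
    refine Lp.ext ?_
    filter_upwards [ha, hb, Lp.coeFn_add a b] with x h1 h2 h3
    rw [h3, Pi.add_apply, h1, h2]
    exact (congrFun (indicator_self_add_compl B p) x).symm
  have hn : ‖a‖ + ‖b‖ ≤ 1 := by
    have h1 : ‖p‖ ≤ 1 := by simpa using hp.1
    refine le_trans (le_of_eq ?_) h1
    rw [L1.norm_eq_integral_norm, L1.norm_eq_integral_norm, L1.norm_eq_integral_norm,
      ← integral_add (L1.integrable_coeFn a).norm (L1.integrable_coeFn b).norm]
    refine integral_congr_ae ?_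
    filter_upwards [ha, hb] with x h1 h2
    rw [h1, h2]
    by_cases hx : x ∈ B <;> simp [hx]
  obtain ⟨t, ht⟩ := exists_smul_eq_of_mem_extremePoints hp hab hn
  have hat : ∀ᵐ x ∂μ, B.indicator p x = t • p x := by
    filter_upwards [ha, Lp.coeFn_smul t p] with x h1 h2
    rw [← h1, ht, h2, Pi.smul_apply]
  rcases eq_or_ne t 1 with rfl | h1
  · left
    filter_upwards [hat] with x hx h0
    by_contra hxB
    simp [hxB] at hx
    exact h0 hx.symm
  · right
    filter_upwards [hat] with x hx h0 hxB
    rw [indicator_of_mem hxB] at hx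
    have : (1 - t) • p x = 0 := by rw [sub_smul, one_smul, ← hx, sub_self]
    rcases smul_eq_zero.1 this with h | h
    · exact h1 (by linarith)
    · exact h0 h

/-- On the atom carrying an extreme point `p`, every function in `L¹(μ)` is a multiple of `p`. -/
theorem exists_ae_eq_mul_of_mem_extremePoints {p : Lp 𝕜 1 μ}
    (hp : p ∈ extremePoints ℝ (Metric.closedBall (0 : Lp 𝕜 1 μ) 1)) (f : Lp 𝕜 1 μ) :
    ∃ c : 𝕜, ∀ᵐ x ∂μ, p x ≠ 0 → f x = c * p x := by
  have hpm : Measurable p := (Lp.stronglyMeasurable p).measurable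
  have hfm : Measurable f := (Lp.stronglyMeasurable f).measurable
  have hA : MeasurableSet {x | p x ≠ 0} := hpm (measurableSet_singleton 0).compl
  have key : ∃ c : 𝕜, (fun x => f x / p x) =ᵐ[μ.restrict {x | p x ≠ 0}] fun _ => c := by
    refine exists_eventuallyEq_const_of_forall_separating MeasurableSet fun U hU => ?_
    rw [ae_restrict_iff' hA, ae_restrict_iff' hA]
    exact ae_mem_or_ae_notMem_of_mem_extremePoints hp ((hfm.div hpm) hU)
  obtain ⟨c, hc⟩ := key
  refine ⟨c, ?_⟩
  filter_upwards [(ae_restrict_iff' hA).1 hc] with x hx h0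
  rw [← hx h0, div_mul_cancel₀ _ h0]

theorem exists_isLCoordinate_Lp {p : Lp 𝕜 1 μ}
    (hp : p ∈ extremePoints ℝ (Metric.closedBall (0 : Lp 𝕜 1 μ) 1)) (h0 : p ≠ 0) :
    ∃ χ : StrongDual 𝕜 (Lp 𝕜 1 μ), IsLCoordinate p χ := by
  choose c hc using exists_ae_eq_mul_of_mem_extremePoints hp
  have hp1 : ‖p‖ = 1 := norm_eq_one_of_mem_extremePoints hp h0
  have uniq : ∀ a b : 𝕜, (∀ᵐ x ∂μ, p x ≠ 0 → a * p x = b * p x) → a = b := by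
    intro a b h
    by_contra hab
    refine h0 (Lp.eq_zero_iff_ae_eq_zero.2 ?_)
    filter_upwards [h] with x hx
    by_contra hpx
    exact hab (mul_right_cancel₀ hpx (hx hpx))
  have norm_eq : ∀ f, ‖f‖ = ‖c f‖ + ‖f - c f • p‖ := by
    intro f
    have h1 : ‖c f‖ = ‖c f • p‖ := by rw [norm_smul, hp1, mul_one]
    rw [h1, L1.norm_eq_integral_norm, L1.norm_eq_integral_norm, L1.norm_eq_integral_norm,
      ← integral_add (L1.integrable_coeFn _).norm (L1.integrable_coeFn _).norm]
    refine integral_congr_ae ?_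
    filter_upwards [hc f, Lp.coeFn_smul (c f) p, Lp.coeFn_sub f (c f • p)] with x h2 h3 h4
    rw [h4, Pi.sub_apply, h3, Pi.smul_apply, smul_eq_mul]
    by_cases hpx : p x = 0
    · simp [hpx]
    · simp [h2 hpx]
  let L : Lp 𝕜 1 μ →ₗ[𝕜] 𝕜 :=
    { toFun := c
      map_add' := fun f g => uniq _ _ <| by
        filter_upwards [hc f, hc g, hc (f + g), Lp.coeFn_add f g] with x h1 h2 h3 h4 hx
        rw [← h3 hx, h4, Pi.add_apply, h1 hx, h2 hx, add_mul]
      map_smul' := fun a f => uniq _ _ <| by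
        filter_upwards [hc f, hc (a • f), Lp.coeFn_smul a f] with x h1 h2 h3 hx
        rw [← h2 hx, h3, Pi.smul_apply, h1 hx, RingHom.id_apply, smul_eq_mul, smul_eq_mul,
          mul_assoc] }
  refine ⟨L.mkContinuous 1 fun f => ?_, ?_, norm_eq⟩
  · rw [one_mul, norm_eq f]
    exact le_add_of_nonneg_right (norm_nonneg _)
  · refine uniq (c p) 1 ?_
    filter_upwards [hc p] with x hx h
    rw [← hx h, one_mul]

end L1

/-! ### Coordinates of an `L`-decomposition -/

namespace IsLCoordinate

variable {𝕜 : Type*} [RCLike 𝕜] {E F : Type*} [NormedAddCommGroup E] [NormedSpace 𝕜 E]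
  [NormedAddCommGroup F] [NormedSpace 𝕜 F] {p q : E} {χ : StrongDual 𝕜 E}

theorem comp_isometry (e : E ≃ₗᵢ[𝕜] F) {χ : StrongDual 𝕜 F}
    (h : IsLCoordinate (e p) χ) : IsLCoordinate p (χ.comp (e : E →L[𝕜] F)) where
  apply_self := by simpa using h.apply_self
  norm_eq f := by
    have := h.norm_eq (e f)
    rw [← map_smul, ← map_sub, e.norm_map, e.norm_map] at this
    simpa using this

theorem norm_apply_le (h : IsLCoordinate p χ) (f : E) : ‖χ f‖ ≤ ‖f‖ := by
  rw [h.norm_eq f]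
  exact le_add_of_nonneg_right (norm_nonneg _)

theorem norm_self (h : IsLCoordinate p χ) : ‖p‖ = 1 := by
  rw [h.norm_eq p, h.apply_self]
  simp

/-- The norms of `p` and `f` add up, except for what the component of `f` along `p` cancels. -/
theorem le_norm_self_add (h : IsLCoordinate p χ) (f : E) :
    1 + ‖f‖ - 2 * ‖χ f‖ ≤ ‖p + f‖ := by
  have h1 := h.norm_eq (p + f)
  have h2 := h.norm_eq f
  rw [map_add, h.apply_self, add_smul, one_smul, add_sub_add_left_eq_sub] at h1
  have h3 : 1 - ‖χ f‖ ≤ ‖1 + χ f‖ := by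
    have := norm_sub_norm_le (1 : 𝕜) (-χ f)
    simpa using this
  linarith

/-- An extreme point that is not proportional to `p` has coordinate `0` at `p`. -/
theorem apply_eq_zero (h : IsLCoordinate p χ) [NormedSpace ℝ E] [IsScalarTower ℝ 𝕜 E]
    (hq : q ∈ extremePoints ℝ (Metric.closedBall (0 : E) 1)) (hpq : ∀ a : 𝕜, a • p ≠ q) :
    χ q = 0 := by
  have hq1 : ‖q‖ ≤ 1 := by simpa using hq.1
  have hn := h.norm_eq q
  by_contra h0
  obtain ⟨t, ht⟩ := exists_smul_eq_of_mem_extremePoints (a := q - χ q • p) (b := χ q • p) hq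
    (by simp) (by rw [norm_smul, h.norm_self]; linarith)
  have h1 : χ (q - χ q • p) = 0 := by simp [h.apply_self]
  have h2 : q - χ q • p = 0 := by
    rcases eq_or_ne t 0 with rfl | ht0
    · simpa using ht
    · exfalso
      have h3 : q = t⁻¹ • (q - χ q • p) := by rw [ht, smul_smul, inv_mul_cancel₀ ht0, one_smul]
      apply h0
      exact h3 ▸ (χ.toLinearMap.map_smul_of_tower t⁻¹ _).trans (by simp [h1])
  exact hpq _ (sub_eq_zero.1 h2).symm

end IsLCoordinate

end Daugavet

namespace Daugavet

open Filter Topology Set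

/-! ### Norming extreme points and second adjoints -/

section Functionals

variable {𝕜 : Type*} [RCLike 𝕜] {X : Type*} [NormedAddCommGroup X] [NormedSpace 𝕜 X]

/-- Every vector attains its norm at an extreme point of the dual unit ball: the norming
functionals form a nonempty weak* compact face. -/
theorem exists_mem_extBall_apply_eq_norm (g : X) :
    ∃ p ∈ extBall 𝕜 X, ‖p g‖ = ‖g‖ := by
  set K : Set (WeakDual 𝕜 X) :=
    WeakDual.toStrongDual ⁻¹' Metric.closedBall (0 : StrongDual 𝕜 X) 1
  set F : Set (WeakDual 𝕜 X) := {p | p ∈ K ∧ RCLike.re (p g) = ‖g‖}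
  have hcont : Continuous fun p : WeakDual 𝕜 X => RCLike.re (p g) :=
    RCLike.continuous_re.comp (WeakDual.eval_continuous g)
  have hle : ∀ p ∈ K, ‖p g‖ ≤ ‖g‖ := by
    intro p hp
    have h1 : ‖WeakDual.toStrongDual p‖ ≤ 1 := by simpa [K] using hp
    simpa using (WeakDual.toStrongDual p).le_of_opNorm_le h1 g
  have hre : ∀ p ∈ K, RCLike.re (p g) ≤ ‖g‖ := fun p hp =>
    (RCLike.re_le_norm _).trans (hle p hp)
  have hFc : IsCompact F :=
    (WeakDual.isCompact_closedBall (0 : StrongDual 𝕜 X) 1).inter_right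
      (isClosed_eq hcont continuous_const)
  have hFn : F.Nonempty := by
    obtain ⟨f, hf, hfg⟩ := exists_dual_vector'' 𝕜 g
    refine ⟨StrongDual.toWeakDual f, ?_, ?_⟩
    · simpa [K] using hf
    · simp [hfg]
  have hext : IsExtreme ℝ K F := by
    refine ⟨fun p hp => hp.1, ?_⟩
    rintro p hp q hq r ⟨-, hr⟩ ⟨a, b, ha, hb, hab, rfl⟩
    refine ⟨hp, le_antisymm (hre p hp) ?_⟩
    have h1 : RCLike.re ((a • p + b • q) g) = a * RCLike.re (p g) + b * RCLike.re (q g) := by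
      change RCLike.re (a • p g + b • q g) = _
      simp [RCLike.smul_re]
    rw [h1] at hr
    have h2 := mul_le_mul_of_nonneg_left (hre q hq) hb.le
    have h3 : ‖g‖ = a * ‖g‖ + b * ‖g‖ := by rw [← add_mul, hab, one_mul]
    exact le_of_mul_le_mul_left (by linarith) ha
  have : LocallyConvexSpace ℝ (WeakDual 𝕜 X) :=
    inferInstanceAs (LocallyConvexSpace ℝ (WeakBilin (topDualPairing 𝕜 X)))
  obtain ⟨p, hp⟩ := hFc.extremePoints_nonempty hFn
  refine ⟨p, hext.extremePoints_subset_extremePoints hp, le_antisymm (hle p hp.1.1) ?_⟩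
  rw [← hp.1.2]
  exact RCLike.re_le_norm _

/-- **Helly's theorem**: on finitely many functionals, an element of the unit ball of the
bidual is approximated by elements of the unit ball of `X`. -/
theorem mem_closure_image_closedBall {ι : Type*} [Fintype ι] (g : ι → StrongDual 𝕜 X)
    {χ : StrongDual 𝕜 (StrongDual 𝕜 X)} (hχ : ∀ f, ‖χ f‖ ≤ ‖f‖) :
    (fun i => χ (g i)) ∈ closure ((fun x i => g i x) '' Metric.closedBall (0 : X) 1) := by
  classical
  let _ : NormedSpace ℝ X := NormedSpace.restrictScalars ℝ 𝕜 X
  have : IsScalarTower ℝ 𝕜 X := RestrictScalars.isScalarTower ℝ 𝕜 X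
  by_contra hmem
  let Φ : X →ₗ[𝕜] (ι → 𝕜) := LinearMap.pi fun i => (g i : X →ₗ[𝕜] 𝕜)
  have hconv : Convex ℝ ((fun x i => g i x) '' Metric.closedBall (0 : X) 1) :=
    (convex_closedBall (0 : X) 1).linear_image (Φ.restrictScalars ℝ)
  obtain ⟨L, u, hL, hu⟩ := RCLike.geometric_hahn_banach_closed_point (𝕜 := 𝕜)
    hconv.closure isClosed_closure hmem
  -- `f` is the functional on `X` that `L` induces through the `g i`
  let f : StrongDual 𝕜 X := ∑ i, L (Pi.single i 1) • g i
  have hsum : ∀ v : ι → 𝕜, L v = ∑ i, L (Pi.single i 1) * v i := by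
    intro v
    have := (L : (ι → 𝕜) →ₗ[𝕜] 𝕜).pi_apply_eq_sum_univ v
    simp only [ContinuousLinearMap.coe_coe, smul_eq_mul] at this
    rw [this]
    refine Finset.sum_congr rfl fun i _ => ?_
    rw [mul_comm]
    congr 2
    funext j
    simp [Pi.single_apply, eq_comm]
  have hfx : ∀ x, L (fun i => g i x) = f x := fun x => by
    rw [hsum]
    simp [f]
  have hfχ : L (fun i => χ (g i)) = χ f := by
    rw [hsum]
    simp [f, map_sum]
  have hfu : ‖f‖ ≤ u := by
    by_contra! hlt
    obtain ⟨x, hx1, hx⟩ := f.exists_lt_apply_of_lt_opNorm hlt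
    obtain ⟨c, hc, hcx⟩ := RCLike.exists_norm_eq_mul_self (f x)
    have h1 := hL (fun i => g i (c • x)) (subset_closure ⟨c • x, by
      simpa [norm_smul, hc] using hx1.le, rfl⟩)
    rw [hfx, map_smul, smul_eq_mul, ← hcx, RCLike.ofReal_re] at h1
    exact lt_asymm h1 hx
  rw [hfχ] at hu
  exact absurd (hu.trans_le ((RCLike.re_le_norm _).trans (hχ f))) (not_lt.2 hfu)

/-- **Gantmacher's theorem**: the second adjoint of a weakly compact operator `T` maps the bidual
into `X`. -/
theorem IsWeaklyCompact.exists_apply_comp_eq {T : X →L[𝕜] X} (hT : IsWeaklyCompact T)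
    {χ : StrongDual 𝕜 (StrongDual 𝕜 X)} (hχ : ∀ f, ‖χ f‖ ≤ ‖f‖) :
    ∃ x : X, ∀ f : StrongDual 𝕜 X, χ (f.comp T) = f x := by
  have hev : ∀ f : StrongDual 𝕜 X,
      Continuous fun k : WeakSpace 𝕜 X => f ((toWeakSpace 𝕜 X).symm k) := fun f =>
    WeakBilin.eval_continuous (topDualPairing 𝕜 X).flip f
  obtain ⟨k, -, hk⟩ := hT.inter_iInter_nonempty
    (fun f : StrongDual 𝕜 X =>
      {k : WeakSpace 𝕜 X | f ((toWeakSpace 𝕜 X).symm k) = χ (f.comp T)})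
    (fun f => isClosed_eq (hev f) continuous_const) (fun u => by
      have hΨ : Continuous fun (k : WeakSpace 𝕜 X) (f : u) =>
          (f : StrongDual 𝕜 X) ((toWeakSpace 𝕜 X).symm k) :=
        continuous_pi fun f => hev f
      have hcl := (hT.image hΨ).isClosed
      have hmem := mem_closure_image_closedBall
        (fun f : u => (f : StrongDual 𝕜 X).comp T) hχ
      obtain ⟨k, hkK, hk⟩ := closure_minimal (by
        rintro _ ⟨x, hx, rfl⟩
        exact ⟨toWeakSpace 𝕜 X (T x), subset_closure ⟨T x, ⟨x, hx, rfl⟩, rfl⟩, by simp⟩)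
        hcl hmem
      refine ⟨k, hkK, mem_iInter₂.2 fun f hf => ?_⟩
      exact congrFun hk ⟨f, hf⟩)
  exact ⟨(toWeakSpace 𝕜 X).symm k, fun f => (mem_iInter.1 hk f).symm⟩

end Functionals

/-! ### Operators factoring through subspaces of `c₀` -/

section CZero

variable {𝕜 : Type*} [RCLike 𝕜] {X : Type*} [NormedAddCommGroup X] [NormedSpace 𝕜 X]

theorem norm_czero_apply_le (g : C₀(ℕ, 𝕜)) (n : ℕ) : ‖g n‖ ≤ ‖g‖ := by
  rw [← ZeroAtInftyContinuousMap.norm_toBCF_eq_norm]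
  exact g.toBCF.norm_coe_le_norm n

theorem norm_czero_le_of_forall_apply_le {g : C₀(ℕ, 𝕜)} {C : ℝ} (hC : 0 ≤ C) (h : ∀ n, ‖g n‖ ≤ C) :
    ‖g‖ ≤ C := by
  rw [← ZeroAtInftyContinuousMap.norm_toBCF_eq_norm]
  exact (BoundedContinuousFunction.norm_le hC).2 h

variable (𝕜) in
/-- The unit vectors of `c₀`. -/
noncomputable def czeroSingle (n : ℕ) : C₀(ℕ, 𝕜) where
  toFun := Pi.single n 1
  continuous_toFun := continuous_of_discreteTopology
  zero_at_infty' := by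
    rw [cocompact_eq_cofinite, Nat.cofinite_eq_atTop]
    refine tendsto_const_nhds.congr' ?_
    filter_upwards [eventually_gt_atTop n] with m hm
    simp [hm.ne']

theorem sum_smul_czeroSingle_apply (s : Finset ℕ) (c : ℕ → 𝕜) (m : ℕ) :
    (∑ n ∈ s, c n • czeroSingle 𝕜 n) m = if m ∈ s then c m else 0 := by
  classical
  have h : ∀ n, (czeroSingle 𝕜 n) m = if m = n then 1 else 0 := fun n => by
    change (Pi.single n 1 : ℕ → 𝕜) m = _
    rw [Pi.single_apply]
  induction s using Finset.induction_on with
  | empty => simp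
  | insert a s ha ih =>
    rw [Finset.sum_insert ha, ZeroAtInftyContinuousMap.add_apply, ih,
      ZeroAtInftyContinuousMap.smul_apply, h]
    by_cases hm : m = a
    · subst hm
      simp [ha]
    · simp [hm]

theorem hasSum_apply_smul_czeroSingle (g : C₀(ℕ, 𝕜)) :
    HasSum (fun n => g n • czeroSingle 𝕜 n) g := by
  have h0 : Tendsto g cofinite (𝓝 0) := by
    rw [← cocompact_eq_cofinite]
    exact g.zero_at_infty'
  rw [HasSum, SummationFilter.unconditional_filter, Metric.tendsto_nhds]
  intro ε hε
  have hfin : {n | ¬ ‖g n‖ < ε / 2}.Finite := by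
    have := (Metric.tendsto_nhds.1 h0) (ε / 2) (half_pos hε)
    simpa [dist_zero_right] using this
  filter_upwards [eventually_ge_atTop hfin.toFinset] with s hs
  rw [dist_eq_norm]
  refine (norm_czero_le_of_forall_apply_le (half_pos hε).le fun m => ?_).trans_lt (half_lt_self hε)
  rw [ZeroAtInftyContinuousMap.sub_apply, sum_smul_czeroSingle_apply]
  split_ifs with hm
  · simp [(half_pos hε).le]
  · rw [zero_sub, norm_neg]
    by_contra! hlt
    exact hm (hs (by simpa using hlt.le))

theorem summable_norm_apply_czeroSingle (Ψ : StrongDual 𝕜 C₀(ℕ, 𝕜)) :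
    Summable fun n => ‖Ψ (czeroSingle 𝕜 n)‖ := by
  choose c hc hcΨ using fun n => RCLike.exists_norm_eq_mul_self (Ψ (czeroSingle 𝕜 n))
  refine summable_of_sum_le (c := ‖Ψ‖) (fun _ => norm_nonneg _) fun s => ?_
  have h1 : ((∑ n ∈ s, ‖Ψ (czeroSingle 𝕜 n)‖ : ℝ) : 𝕜) =
      Ψ (∑ n ∈ s, c n • czeroSingle 𝕜 n) := by
    simp [map_sum, hcΨ]
  have h2 : ‖∑ n ∈ s, c n • czeroSingle 𝕜 n‖ ≤ 1 := by
    refine norm_czero_le_of_forall_apply_le zero_le_one fun m => ?_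
    rw [sum_smul_czeroSingle_apply]
    split_ifs <;> simp [hc]
  calc ∑ n ∈ s, ‖Ψ (czeroSingle 𝕜 n)‖
      ≤ ‖((∑ n ∈ s, ‖Ψ (czeroSingle 𝕜 n)‖ : ℝ) : 𝕜)‖ := by
        rw [RCLike.norm_ofReal]
        exact le_abs_self _
    _ ≤ ‖Ψ‖ := by
        rw [h1]
        exact (Ψ.le_opNorm _).trans (mul_le_of_le_one_right (norm_nonneg _) h2)

/-- If `T` factors through a subspace of `c₀`, then the range of its adjoint consists of sums of
absolutely convergent series in the coordinate functionals `φ n` of the first factor, because the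
dual of `c₀` is `ℓ¹`. -/
theorem FactorsThroughSubspaceOfC0.exists_hasSum {T : X →L[𝕜] X}
    (hT : FactorsThroughSubspaceOfC0 T) :
    ∃ φ : ℕ → StrongDual 𝕜 X, ∀ p : StrongDual 𝕜 X, ∃ a : ℕ → 𝕜,
      HasSum (fun n => a n • φ n) (p.comp T) := by
  obtain ⟨E, -, T₁, T₂, rfl⟩ := hT
  let S : X →L[𝕜] C₀(ℕ, 𝕜) := E.subtypeL.comp T₁
  have hφ : ∀ n, ∃ φ : StrongDual 𝕜 X, (∀ x, φ x = S x n) ∧ ‖φ‖ ≤ ‖S‖ := by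
    intro n
    have hb : ∀ x, ‖S x n‖ ≤ ‖S‖ * ‖x‖ := fun x =>
      (norm_czero_apply_le _ n).trans (S.le_opNorm x)
    exact ⟨LinearMap.mkContinuous
      { toFun := fun x => S x n
        map_add' := by simp
        map_smul' := by simp } ‖S‖ hb, fun _ => rfl,
      LinearMap.mkContinuous_norm_le _ S.opNorm_nonneg _⟩
  choose φ hφ hφn using hφ
  refine ⟨φ, fun p => ?_⟩
  obtain ⟨Ψ, hΨ, -⟩ := exists_extension_norm_eq E (p.comp T₂)
  have hs : Summable fun n => Ψ (czeroSingle 𝕜 n) • φ n := by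
    refine Summable.of_norm_bounded
      ((summable_norm_apply_czeroSingle Ψ).mul_right ‖S‖) fun n => ?_
    rw [norm_smul]
    exact mul_le_mul_of_nonneg_left (hφn n) (norm_nonneg _)
  refine ⟨fun n => Ψ (czeroSingle 𝕜 n), ?_⟩
  convert hs.hasSum
  ext x
  have h1 : HasSum (fun n => Ψ (czeroSingle 𝕜 n) * φ n x)
      ((∑' n, Ψ (czeroSingle 𝕜 n) • φ n) x) := by
    simpa using (ContinuousLinearMap.apply 𝕜 𝕜 x).hasSum hs.hasSum
  have h2 : HasSum (fun n => Ψ (czeroSingle 𝕜 n) * φ n x) (Ψ (S x)) := by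
    simpa [hφ, mul_comm] using Ψ.hasSum (hasSum_apply_smul_czeroSingle (S x))
  rw [h1.unique h2]
  exact (hΨ (T₁ x)).symm

end CZero

end Daugavet

namespace Daugavet

open Filter Topology Set

/-! ### Classes of extreme points of the dual ball -/

section Representatives

variable {𝕜 : Type*} [RCLike 𝕜] {X : Type*} [NormedAddCommGroup X] [NormedSpace 𝕜 X]

/-- Let `p` and `q` be norm-one functionals such that `q` has no component along `p`. Then `q` is at
distance `1` from the line `𝕜 p`, so by Hahn–Banach its restriction to the kernel of `p` has norm at
least `1`. -/
theorem IsLCoordinate.exists_apply_eq_zero {p q : StrongDual 𝕜 X}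
    {χ : StrongDual 𝕜 (StrongDual 𝕜 X)} (h : IsLCoordinate p χ) (hχq : χ q = 0)
    (hq : ‖q‖ = 1) : ∃ x : X, p x = 0 ∧ ‖x‖ ≤ 1 ∧ 1 / 2 < ‖q x‖ := by
  obtain ⟨g, hg, hgn⟩ := exists_extension_norm_eq (LinearMap.ker p.toLinearMap)
    (q.comp (LinearMap.ker p.toLinearMap).subtypeL)
  have hp0 : p ≠ 0 := by
    intro h0
    simpa [h0] using h.norm_self
  obtain ⟨x₀, hx₀⟩ : ∃ x, p x ≠ 0 := by
    by_contra! hall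
    exact hp0 (ContinuousLinearMap.ext hall)
  -- `q` and its norm-preserving modification `g` agree on the kernel of `p`
  obtain ⟨a, ha⟩ : ∃ a : 𝕜, g = q - a • p := by
    refine ⟨(q x₀ - g x₀) / p x₀, ContinuousLinearMap.ext fun x => ?_⟩
    have hker : p (x - (p x / p x₀) • x₀) = 0 := by
      simp [div_mul_cancel₀ _ hx₀]
    have h1 := hg ⟨_, LinearMap.mem_ker.2 hker⟩
    simp only [map_sub, map_smul, smul_eq_mul, ContinuousLinearMap.comp_apply,
      Submodule.subtypeL_apply] at h1
    simp only [sub_apply, smul_apply, smul_eq_mul]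
    field_simp
    field_simp at h1
    linear_combination h1
  have hgq : 1 ≤ ‖g‖ := by
    have h1 := h.norm_eq g
    have h2 : χ g = -a := by
      rw [ha]
      simp [hχq, h.apply_self]
    rw [h2, ha] at h1
    have h3 : q - a • p - -a • p = q := by module
    rw [h3, hq, ← ha] at h1
    rw [h1]
    exact le_add_of_nonneg_left (norm_nonneg _)
  rw [hgn] at hgq
  obtain ⟨x, hx1, hx⟩ := ContinuousLinearMap.exists_lt_apply_of_lt_opNorm _
    (lt_of_lt_of_le (by norm_num : (1 / 2 : ℝ) < 1) hgq)
  exact ⟨x, LinearMap.mem_ker.1 x.2, hx1.le, hx⟩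

/-- A functional representing a class of extreme points of the dual unit ball. -/
noncomputable def rep (s : ExtQuotient 𝕜 X) : StrongDual 𝕜 X :=
  WeakDual.toStrongDual (s.out : WeakDual 𝕜 X)

theorem rep_mem (s : ExtQuotient 𝕜 X) :
    rep s ∈ extremePoints ℝ (Metric.closedBall (0 : StrongDual 𝕜 X) 1) :=
  s.out.2

variable [Nontrivial X]

theorem norm_toStrongDual_of_mem_extBall {p : WeakDual 𝕜 X} (hp : p ∈ extBall 𝕜 X) :
    ‖WeakDual.toStrongDual p‖ = 1 :=
  norm_eq_one_of_mem_extremePoints hp fun h => ne_zero_of_mem_extBall hp h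

theorem norm_rep (s : ExtQuotient 𝕜 X) : ‖rep s‖ = 1 :=
  norm_toStrongDual_of_mem_extBall s.out.2

theorem mk_eq_mk_iff {p q : extBall 𝕜 X} :
    (Quotient.mk (extSetoid 𝕜 X) p = Quotient.mk (extSetoid 𝕜 X) q) ↔
      ∃ a : 𝕜, a • (p : WeakDual 𝕜 X) = q := by
  rw [Quotient.eq]
  exact linDep_iff (ne_zero_of_mem_extBall p.2)

/-- Equivalent extreme points differ by a unimodular factor. -/
theorem norm_rep_mk_apply (p : extBall 𝕜 X) (x : X) :
    ‖rep (Quotient.mk (extSetoid 𝕜 X) p) x‖ = ‖(p : WeakDual 𝕜 X) x‖ := by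
  obtain ⟨a, ha⟩ := mk_eq_mk_iff.1 (Quotient.out_eq (Quotient.mk (extSetoid 𝕜 X) p))
  have h1 : WeakDual.toStrongDual (p : WeakDual 𝕜 X) =
      a • rep (Quotient.mk (extSetoid 𝕜 X) p) := by
    rw [← ha]
    rfl
  have h2 : ‖a‖ = 1 := by
    have := norm_toStrongDual_of_mem_extBall p.2
    rwa [h1, norm_smul, norm_rep, mul_one] at this
  rw [← WeakDual.toStrongDual_apply, h1, smul_apply, norm_smul, h2, one_mul]

theorem continuous_norm_rep_apply (x : X) :
    Continuous fun s : ExtQuotient 𝕜 X => ‖rep s x‖ := by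
  refine (isQuotientMap_quotient_mk' (s := extSetoid 𝕜 X)).continuous_iff.2 ?_
  have h : Continuous fun p : extBall 𝕜 X => ‖(p : WeakDual 𝕜 X) x‖ :=
    ((WeakDual.eval_continuous x).comp continuous_subtype_val).norm
  exact h.congr fun p => (norm_rep_mk_apply p x).symm

theorem exists_norm_rep_apply_eq (g : X) : ∃ s : ExtQuotient 𝕜 X, ‖rep s g‖ = ‖g‖ := by
  obtain ⟨p, hp, hpg⟩ := exists_mem_extBall_apply_eq_norm (𝕜 := 𝕜) g
  exact ⟨Quotient.mk _ ⟨p, hp⟩, (norm_rep_mk_apply ⟨p, hp⟩ g).trans hpg⟩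

variable {χ : ExtQuotient 𝕜 X → StrongDual 𝕜 (StrongDual 𝕜 X)}

theorem coordinate_rep_of_ne (hχ : ∀ s, IsLCoordinate (rep s) (χ s)) {s t : ExtQuotient 𝕜 X}
    (hst : s ≠ t) : χ s (rep t) = 0 := by
  refine (hχ s).apply_eq_zero (rep_mem t) fun a ha => hst ?_
  rw [← Quotient.out_eq s, ← Quotient.out_eq t]
  exact mk_eq_mk_iff.2 ⟨a, ha⟩

/-- The lines spanned by inequivalent extreme points form an `ℓ¹`-sum inside the dual. -/
theorem sum_norm_coordinate_le (hχ : ∀ s, IsLCoordinate (rep s) (χ s))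
    (F : Finset (ExtQuotient 𝕜 X)) (f : StrongDual 𝕜 X) : ∑ s ∈ F, ‖χ s f‖ ≤ ‖f‖ := by
  classical
  induction F using Finset.induction_on generalizing f with
  | empty => simp
  | insert s F hs ih =>
    rw [Finset.sum_insert hs, (hχ s).norm_eq f]
    refine add_le_add_right (le_trans (le_of_eq ?_) (ih (f - χ s f • rep s))) _
    refine Finset.sum_congr rfl fun t ht => ?_
    have hts : t ≠ s := fun h => hs (h ▸ ht)
    simp [coordinate_rep_of_ne hχ hts]

theorem countable_setOf_coordinate_ne_zero (hχ : ∀ s, IsLCoordinate (rep s) (χ s))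
    (f : StrongDual 𝕜 X) : {s | χ s f ≠ 0}.Countable := by
  have h : Summable fun s => ‖χ s f‖ :=
    summable_of_sum_le (fun _ => norm_nonneg _) fun F => sum_norm_coordinate_le hχ F f
  refine h.countable_support.mono fun s hs => ?_
  simpa using hs

theorem t1Space_extQuotient (hχ : ∀ s, IsLCoordinate (rep s) (χ s)) :
    T1Space (ExtQuotient 𝕜 X) := by
  rw [t1Space_iff_exists_open]
  intro t s hts
  obtain ⟨x, hx0, -, hx⟩ :=
    (hχ s).exists_apply_eq_zero (coordinate_rep_of_ne hχ hts.symm) (norm_rep t)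
  refine ⟨{r | 0 < ‖rep r x‖}, isOpen_lt continuous_const (continuous_norm_rep_apply x), ?_, ?_⟩
  · exact lt_trans (by norm_num) hx
  · simp [hx0]

/-- If the class of `s` is not isolated, then the vectors that do not attain their norm at `s` are
dense. Otherwise `s` norms a whole ball around some `y`; moving `y` inside the kernel of `rep s`
then shows that all other classes stay below a level less than `‖y‖` at `y`. -/
theorem dense_setOf_norm_rep_apply_lt (hχ : ∀ s, IsLCoordinate (rep s) (χ s))
    {s : ExtQuotient 𝕜 X} (hs : ¬ IsOpen ({s} : Set (ExtQuotient 𝕜 X))) :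
    Dense {g : X | ‖rep s g‖ < ‖g‖} := by
  rw [Metric.dense_iff]
  intro y ε hε
  by_contra hempty
  have hball : ∀ g, ‖g - y‖ < ε → ‖g‖ ≤ ‖rep s g‖ := by
    intro g hg
    by_contra! hlt
    exact hempty ⟨g, by rwa [Metric.mem_ball, dist_eq_norm], hlt⟩
  apply hs
  have hset : ({s} : Set (ExtQuotient 𝕜 X)) = {t | ‖y‖ - ε / 4 < ‖rep t y‖} := by
    ext t
    rw [mem_singleton_iff, mem_ofPred_eq]
    constructor
    · rintro rfl
      have := hball y (by simpa using hε)
      linarith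
    · intro ht
      by_contra hts
      obtain ⟨h, hh0, hh1, hh⟩ :=
        (hχ s).exists_apply_eq_zero (coordinate_rep_of_ne hχ (Ne.symm hts)) (norm_rep t)
      -- rotate `h` so that its image under `rep t` points in the direction of `rep t y`
      obtain ⟨c, hc, hcy⟩ := RCLike.exists_norm_mul_eq_self (rep t y)
      obtain ⟨d, hd, hdh⟩ := RCLike.exists_norm_eq_mul_self (rep t h)
      set g := y + (((ε / 2 : ℝ) : 𝕜) * (c * d)) • h with hg
      have hε2 : ‖((ε / 2 : ℝ) : 𝕜)‖ = ε / 2 := by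
        rw [RCLike.norm_ofReal, abs_of_pos (half_pos hε)]
      have h1 : ‖g - y‖ < ε := by
        rw [hg, add_sub_cancel_left, norm_smul, norm_mul, norm_mul, hc, hd, hε2]
        nlinarith
      have h2 : rep t g = c * ((‖rep t y‖ + ε / 2 * ‖rep t h‖ : ℝ) : 𝕜) := by
        rw [hg, map_add, map_smul, smul_eq_mul]
        have h3 : ((ε / 2 * ‖rep t h‖ : ℝ) : 𝕜) = ((ε / 2 : ℝ) : 𝕜) * (d * rep t h) := by
          rw [← hdh, RCLike.ofReal_mul]
        rw [RCLike.ofReal_add, h3]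
        linear_combination -hcy
      have h3 : ‖rep t g‖ = ‖rep t y‖ + ε / 2 * ‖rep t h‖ := by
        rw [h2, norm_mul, hc, one_mul, RCLike.norm_ofReal, abs_of_nonneg (by positivity)]
      have h4 : ‖rep t g‖ ≤ ‖g‖ := by
        simpa [norm_rep] using (rep t).le_opNorm g
      have h5 : rep s g = rep s y := by simp [hg, hh0]
      have h6 : ‖rep s y‖ ≤ ‖y‖ := by
        simpa [norm_rep] using (rep s).le_opNorm y
      have h7 := hball g h1
      rw [h5] at h7
      nlinarith
  rw [hset]
  exact isOpen_lt continuous_const (continuous_norm_rep_apply y)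

/-- Any vector is almost normed by a class of extreme points outside a given countable set, by the
Baire category theorem in `X`. -/
theorem exists_notMem_countable_lt_norm_rep_apply [CompleteSpace X]
    (hχ : ∀ s, IsLCoordinate (rep s) (χ s))
    (hiso : ∀ s : ExtQuotient 𝕜 X, ¬ IsOpen ({s} : Set (ExtQuotient 𝕜 X)))
    {C : Set (ExtQuotient 𝕜 X)} (hC : C.Countable) (y : X) {ε : ℝ} (hε : 0 < ε) :
    ∃ s ∉ C, ‖y‖ - ε < ‖rep s y‖ := by
  have hd : Dense (⋂ s ∈ C, {g : X | ‖rep s g‖ < ‖g‖}) :=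
    dense_biInter_of_isOpen
      (fun s _ => isOpen_lt (rep s).continuous.norm continuous_norm) hC
      (fun s _ => dense_setOf_norm_rep_apply_lt hχ (hiso s))
  obtain ⟨g, hgy, hg⟩ := Metric.dense_iff.1 hd y (ε / 2) (half_pos hε)
  obtain ⟨s, hs⟩ := exists_norm_rep_apply_eq (𝕜 := 𝕜) g
  refine ⟨s, fun hsC => ?_, ?_⟩
  · have : ‖rep s g‖ < ‖g‖ := mem_iInter₂.1 hg s hsC
    exact this.ne hs
  · rw [Metric.mem_ball, dist_eq_norm] at hgy
    have h1 : ‖rep s (g - y)‖ ≤ ‖g - y‖ := by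
      simpa [norm_rep] using (rep s).le_opNorm (g - y)
    have h2 : ‖rep s g‖ ≤ ‖rep s y‖ + ‖rep s (g - y)‖ := by
      have := norm_add_le (rep s y) (rep s (g - y))
      rwa [← map_add, add_sub_cancel] at this
    have h3 : ‖y‖ ≤ ‖g‖ + ‖g - y‖ := by
      have := norm_sub_le g (g - y)
      rwa [sub_sub_cancel] at this
    linarith

end Representatives

/-! ### The Daugavet equation -/

section Operators

variable {𝕜 : Type*} [RCLike 𝕜] {X : Type*} [NormedAddCommGroup X] [NormedSpace 𝕜 X]
  [Nontrivial X] {χ : ExtQuotient 𝕜 X → StrongDual 𝕜 (StrongDual 𝕜 X)}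

/-- The Daugavet equation holds as soon as every vector is almost normed by an extreme point `p`
for which the component of `p.comp T` along `p` is small. -/
theorem satisfiesDaugavet_of_small_diagonal (hχ : ∀ s, IsLCoordinate (rep s) (χ s))
    (T : X →L[𝕜] X)
    (h : ∀ (y : X) (ε : ℝ), 0 < ε →
      ∃ s, ‖y‖ - ε < ‖rep s y‖ ∧ ‖χ s ((rep s).comp T)‖ < ε) :
    SatisfiesDaugavet T := by
  refine le_antisymm ((norm_add_le _ _).trans
    (add_le_add_left ContinuousLinearMap.norm_id_le _)) ?_
  refine le_of_forall_pos_le_add fun ε hε => ?_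
  obtain ⟨x, hx1, hx⟩ := T.exists_lt_apply_of_lt_opNorm (sub_lt_self ‖T‖ (by positivity : 0 < ε / 4))
  obtain ⟨s, hs, hsT⟩ := h (T x) (ε / 4) (by positivity)
  have h1 := (hχ s).le_norm_self_add ((rep s).comp T)
  have h2 : ‖rep s (T x)‖ ≤ ‖(rep s).comp T‖ :=
    (((rep s).comp T).le_opNorm x).trans (mul_le_of_le_one_right (norm_nonneg _) hx1.le)
  have h3 : ‖rep s + (rep s).comp T‖ ≤ ‖ContinuousLinearMap.id 𝕜 X + T‖ := by
    have h4 : rep s + (rep s).comp T = (rep s).comp (ContinuousLinearMap.id 𝕜 X + T) := by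
      ext x
      simp
    rw [h4]
    refine (ContinuousLinearMap.opNorm_comp_le _ _).trans ?_
    rw [norm_rep, one_mul]
  linarith

/-- Only countably many classes carry a nonzero coordinate of one of the functionals whose series
make up the range of the adjoint; the extreme points outside them see no diagonal at all. -/
theorem FactorsThroughSubspaceOfC0.satisfiesDaugavet [CompleteSpace X]
    (hχ : ∀ s, IsLCoordinate (rep s) (χ s))
    (hiso : ∀ s : ExtQuotient 𝕜 X, ¬ IsOpen ({s} : Set (ExtQuotient 𝕜 X)))
    {T : X →L[𝕜] X} (hT : FactorsThroughSubspaceOfC0 T) : SatisfiesDaugavet T := by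
  obtain ⟨φ, hφ⟩ := hT.exists_hasSum
  have hC : (⋃ n, {s | χ s (φ n) ≠ 0}).Countable :=
    countable_iUnion fun n => countable_setOf_coordinate_ne_zero hχ (φ n)
  refine satisfiesDaugavet_of_small_diagonal hχ T fun y ε hε => ?_
  obtain ⟨s, hsC, hs⟩ := exists_notMem_countable_lt_norm_rep_apply hχ hiso hC y hε
  refine ⟨s, hs, ?_⟩
  have h0 : ∀ n, χ s (φ n) = 0 := by
    simpa using hsC
  obtain ⟨a, ha⟩ := hφ (rep s)
  have h1 := (χ s).hasSum ha
  simp only [map_smul, h0, smul_zero] at h1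
  rw [h1.unique hasSum_zero, norm_zero]
  exact hε

/-- If the diagonal coordinates of the adjoint of a weakly compact `T` were bounded below by `β` on
an open set `U` of classes, then arbitrarily many coordinates would simultaneously exceed `β`
on some smaller open set, since every coordinate of `(rep t).comp T` depends continuously on `t`. -/
theorem IsWeaklyCompact.exists_finset_lt_coordinate {T : X →L[𝕜] X} (hT : IsWeaklyCompact T)
    (hχ : ∀ s, IsLCoordinate (rep s) (χ s))
    (hiso : ∀ s : ExtQuotient 𝕜 X, ¬ IsOpen ({s} : Set (ExtQuotient 𝕜 X)))
    {U : Set (ExtQuotient 𝕜 X)} (hU : IsOpen U) (hUn : U.Nonempty) {β : ℝ}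
    (hβ : ∀ s ∈ U, β < ‖χ s ((rep s).comp T)‖) (n : ℕ) :
    ∃ (F : Finset (ExtQuotient 𝕜 X)) (V : Set (ExtQuotient 𝕜 X)), F.card = n ∧ IsOpen V ∧
      V.Nonempty ∧ V ⊆ U ∧ ∀ s ∈ F, ∀ t ∈ V, β < ‖χ s ((rep t).comp T)‖ := by
  classical
  have := t1Space_extQuotient hχ
  induction n with
  | zero => exact ⟨∅, U, rfl, hU, hUn, subset_rfl, by simp⟩
  | succ n ih =>
    obtain ⟨F, V, hF, hV, ⟨t₀, ht₀⟩, hVU, hFV⟩ := ih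
    have : (𝓝[≠] t₀).NeBot := by
      rw [neBot_iff, Ne, ← isOpen_singleton_iff_punctured_nhds]
      exact hiso t₀
    -- there are no isolated classes, so the open set `V` is infinite
    obtain ⟨s, hsV, hsF⟩ := (infinite_of_mem_nhds t₀ (hV.mem_nhds ht₀)).exists_notMem_finset F
    obtain ⟨x, hx⟩ := hT.exists_apply_comp_eq (hχ s).norm_apply_le
    refine ⟨insert s F, V ∩ {t | β < ‖rep t x‖}, by rw [Finset.card_insert_of_notMem hsF, hF],
      hV.inter (isOpen_lt continuous_const (continuous_norm_rep_apply x)), ⟨s, hsV, ?_⟩,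
      inter_subset_left.trans hVU, ?_⟩
    · rw [mem_ofPred_eq, ← hx]
      exact hβ s (hVU hsV)
    · intro r hr t ht
      rcases Finset.mem_insert.1 hr with rfl | hr
      · rw [hx]
        exact ht.2
      · exact hFV r hr t ht.1

theorem IsWeaklyCompact.satisfiesDaugavet {T : X →L[𝕜] X} (hT : IsWeaklyCompact T)
    (hχ : ∀ s, IsLCoordinate (rep s) (χ s))
    (hiso : ∀ s : ExtQuotient 𝕜 X, ¬ IsOpen ({s} : Set (ExtQuotient 𝕜 X))) :
    SatisfiesDaugavet T := by
  refine satisfiesDaugavet_of_small_diagonal hχ T fun y ε hε => ?_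
  by_contra! hcon
  obtain ⟨s₀, hs₀⟩ := exists_norm_rep_apply_eq (𝕜 := 𝕜) y
  obtain ⟨n, hn⟩ := exists_nat_gt (‖T‖ / (ε / 2))
  obtain ⟨F, V, hF, -, ⟨t, ht⟩, -, hFV⟩ := hT.exists_finset_lt_coordinate hχ hiso
    (U := {s | ‖y‖ - ε < ‖rep s y‖}) (isOpen_lt continuous_const (continuous_norm_rep_apply y))
    ⟨s₀, by rw [mem_ofPred_eq, hs₀]; exact sub_lt_self _ hε⟩
    (β := ε / 2) (fun s hs => (half_lt_self hε).trans_le (hcon s hs)) n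
  have h1 : (n : ℝ) * (ε / 2) ≤ ∑ s ∈ F, ‖χ s ((rep t).comp T)‖ := by
    rw [← hF, ← nsmul_eq_mul]
    exact Finset.card_nsmul_le_sum F _ _ fun s hs => (hFV s hs t ht).le
  have h2 := sum_norm_coordinate_le hχ F ((rep t).comp T)
  have h3 : ‖(rep t).comp T‖ ≤ ‖T‖ := by
    simpa [norm_rep] using (rep t).opNorm_comp_le T
  rw [div_lt_iff₀ (half_pos hε)] at hn
  linarith

theorem IsL1Predual.exists_isLCoordinate (hX : IsL1Predual.{_, _, w} 𝕜 X)
    (s : ExtQuotient 𝕜 X) :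
    ∃ χ : StrongDual 𝕜 (StrongDual 𝕜 X), IsLCoordinate (rep s) χ := by
  obtain ⟨Ω, _, μ, ⟨e⟩⟩ := hX
  have hmem : e (rep s) ∈ extremePoints ℝ (Metric.closedBall (0 : MeasureTheory.Lp 𝕜 1 μ) 1) := by
    have h := mem_image_of_mem (e.toLinearEquiv.restrictScalars ℝ) (rep_mem s)
    rw [image_extremePoints] at h
    have hball : (e.toLinearEquiv.restrictScalars ℝ) ''
        Metric.closedBall (0 : StrongDual 𝕜 X) 1 =
        Metric.closedBall (0 : MeasureTheory.Lp 𝕜 1 μ) 1 := by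
      have := e.image_closedBall 0 1
      rwa [map_zero] at this
    rwa [hball] at h
  have h0 : e (rep s) ≠ 0 := by
    rw [← norm_ne_zero_iff, e.norm_map, norm_rep]
    exact one_ne_zero
  obtain ⟨χ, h⟩ := exists_isLCoordinate_Lp hmem h0
  exact ⟨_, h.comp_isometry e⟩

end Operators

end Daugavet

theorem theorem3p5 {𝕜 : Type u} [RCLike 𝕜]
    {X : Type v} [NormedAddCommGroup X] [NormedSpace 𝕜 X] [CompleteSpace X]
    (hX : Daugavet.IsL1Predual.{u, v, w} 𝕜 X)
    (hiso : ∀ x : Daugavet.ExtQuotient 𝕜 X, ¬ IsOpen ({x} : Set (Daugavet.ExtQuotient 𝕜 X)))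
    (T : X →L[𝕜] X)
    (hT : Daugavet.IsWeaklyCompact T ∨ Daugavet.FactorsThroughSubspaceOfC0 T) :
    Daugavet.SatisfiesDaugavet T := by
  have : Nontrivial X := by
    by_contra hX'
    rw [not_nontrivial_iff_subsingleton] at hX'
    -- over the zero space, `0` is the only extreme point and hence isolated
    have hsub : Subsingleton (WeakDual 𝕜 X) :=
      ⟨fun p q => DFunLike.ext _ _ fun x => by rw [Subsingleton.elim x 0, map_zero, map_zero]⟩
    obtain ⟨p, hp, -⟩ := Daugavet.exists_mem_extBall_apply_eq_norm (𝕜 := 𝕜) (0 : X)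
    have hsub' : Subsingleton (Daugavet.ExtQuotient 𝕜 X) :=
      Quotient.instSubsingletonQuotient _
    exact hiso (Quotient.mk _ ⟨p, hp⟩) (isOpen_discrete _)
  choose χ hχ using hX.exists_isLCoordinate
  exact hT.elim (fun h => h.satisfiesDaugavet hχ hiso) (fun h => h.satisfiesDaugavet hχ hiso)
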